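/- Let $d\in\mathbb{N}$, $\mathcal{H}=\mathbb{C}^d\otimes\mathbb{C}^d$, and let $\mathcal{D}(\mathcal{K})$ denote the set of positive semidefinite operators of trace one on a finite-dimensional Hilbert space $\mathcal{K}$. For a bipartite state $\rho\in\mathcal{D}(\mathcal{H}_A\otimes\mathcal{H}_B)$ let $$F_2(\rho)=\sup_{A,B}\frac{\mathrm{tr}[(A\otimes B)^\dagger\rho(A\otimes B)\,\phi_2]}{\mathrm{tr}[(A\otimes B)^\dagger\rho(A\otimes B)]},\qquad \phi_2=\frac12\sum_{i,j=0}^{1}|i,i\rangle\langle j,j|,$$ where the supremum is over all linear maps $A:\mathbb{C}^2\to\mathcal{H}_A$ and $B:\mathbb{C}^2\to\mathcal{H}_B$ for which the denominator is nonzero. For $k\ge 1$ the space $\mathcal{H}^{\otimes k}$ is regarded as bipartite by giving the $k$ first factors $\mathbb{C}^d$ to one party and the $k$ second factors to the other. Let $\mathcal{C}$ be the set of undistillable states, i.e. of all $\rho\in\mathcal{D}(\mathcal{H})$ with $F_2(\rho^{\otimes n})=1/2$ for every $n\ge1$. For $k\ge 1$ let $\mathcal{T}_k$ be the set of all $\rho\in\mathcal{D}(\mathcal{H})$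 for which there is a state $\omega_k\in\mathcal{D}(\mathcal{H}^{\otimes k})$ such that $P_\pi\omega_kP_\pi^\dagger=\omega_k$ for every permutation $\pi\in S_k$ (with $P_\pi$ permuting the $k$ copies of $\mathcal{H}$), $F_2(\omega_k)=1/2$, and the partial trace of $\omega_k$ over all copies but the first is $\rho$. Let $\mathcal{T}=\bigcap_{k\ge1}\mathcal{T}_k$ be the set of copy-correlated undistillable states. Then $$\mathcal{T}=\mathrm{co}(\mathcal{C}),$$ where $\mathrm{co}$ denotes the convex hull. -/

import Mathlib

open scoped Kronecker Matrix ComplexOrder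

noncomputable section

namespace CopyCorrelated

/-- The state space over `ℂ^ι`: positive semidefinite matrices of trace one. -/
def states (ι : Type*) [Fintype ι] : Set (Matrix ι ι ℂ) :=
  {ρ | ρ.PosSemidef ∧ ρ.trace = 1}

/-- The projector `φ₂ = ½ ∑_{i,j} |i,i⟩⟨j,j|` onto the two-qubit maximally entangled state. -/
def phi2 : Matrix (Fin 2 × Fin 2) (Fin 2 × Fin 2) ℂ :=
  Matrix.of fun p q => if p.1 = p.2 ∧ q.1 = q.2 then 1 / 2 else 0

/-- The unnormalized two-qubit output `(A ⊗ B)† ρ (A ⊗ B)` of a local filter. -/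
def filtered {a b : Type*} [Fintype a] [Fintype b] (ρ : Matrix (a × b) (a × b) ℂ)
    (A : Matrix a (Fin 2) ℂ) (B : Matrix b (Fin 2) ℂ) :
    Matrix (Fin 2 × Fin 2) (Fin 2 × Fin 2) ℂ :=
  (A ⊗ₖ B)ᴴ * ρ * (A ⊗ₖ B)

/-- The SLOCC singlet fraction `F₂`: the supremum of
`tr[(A ⊗ B)† ρ (A ⊗ B) φ₂] / tr[(A ⊗ B)† ρ (A ⊗ B)]` over all local filters `A`, `B` that succeed
with nonzero probability. If `ρ` is a state, both traces are real and nonnegative, and the set of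
ratios is nonempty and contained in `[0, 1]`. -/
def singletFraction {a b : Type*} [Fintype a] [Fintype b]
    (ρ : Matrix (a × b) (a × b) ℂ) : ℝ :=
  sSup {r : ℝ | ∃ (A : Matrix a (Fin 2) ℂ) (B : Matrix b (Fin 2) ℂ),
    (filtered ρ A B).trace ≠ 0 ∧
      r = (filtered ρ A B * phi2).trace.re / (filtered ρ A B).trace.re}

/-- Single-copy undistillable bipartite states on `ℂ^a ⊗ ℂ^b`. -/
def singleCopyUndistillable (a b : Type*) [Fintype a] [Fintype b] :
    Set (Matrix (a × b) (a × b) ℂ) :=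
  {ρ | ρ ∈ states (a × b) ∧ singletFraction ρ = 1 / 2}

/-- An operator on `(ℂ^a ⊗ ℂ^b)^{⊗ k}` seen as a bipartite operator on
`(ℂ^a)^{⊗ k} ⊗ (ℂ^b)^{⊗ k}`: one party holds all the first factors, the other all the second
factors. -/
def regroup {a b : Type*} {k : ℕ} (ω : Matrix (Fin k → a × b) (Fin k → a × b) ℂ) :
    Matrix ((Fin k → a) × (Fin k → b)) ((Fin k → a) × (Fin k → b)) ℂ :=
  ω.submatrix (fun p m => (p.1 m, p.2 m)) (fun p m => (p.1 m, p.2 m))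

/-- The tensor power `ρ^{⊗ n}`. -/
def tensorPower {ι : Type*} (ρ : Matrix ι ι ℂ) (n : ℕ) :
    Matrix (Fin n → ι) (Fin n → ι) ℂ :=
  Matrix.of fun i j => ∏ m, ρ (i m) (j m)

/-- The `n`-undistillable states on `ℂ^d ⊗ ℂ^d`: those with `F₂(ρ^{⊗ n}) = 1/2`. -/
def nUndistillable (d n : ℕ) : Set (Matrix (Fin d × Fin d) (Fin d × Fin d) ℂ) :=
  {ρ | ρ ∈ states (Fin d × Fin d) ∧ singletFraction (regroup (tensorPower ρ n)) = 1 / 2}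

/-- The set `C` of undistillable states on `ℂ^d ⊗ ℂ^d`. -/
def undistillable (d : ℕ) : Set (Matrix (Fin d × Fin d) (Fin d × Fin d) ℂ) :=
  {ρ | ∀ n : ℕ, 0 < n → ρ ∈ nUndistillable d n}

/-- The unitary on `(ℂ^ι)^{⊗ k}` that permutes the tensor factors:
`P_π |j₁, …, j_k⟩ = |j_{π⁻¹(1)}, …, j_{π⁻¹(k)}⟩`. -/
def permOp {ι : Type*} [DecidableEq ι] {k : ℕ} (π : Equiv.Perm (Fin k)) :
    Matrix (Fin k → ι) (Fin k → ι) ℂ :=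
  Matrix.of fun i j => if i = j ∘ π.symm then 1 else 0

/-- The permutation-symmetric states on `(ℂ^ι)^{⊗ k}`. -/
def symmetricStates (ι : Type*) [Fintype ι] [DecidableEq ι] (k : ℕ) :
    Set (Matrix (Fin k → ι) (Fin k → ι) ℂ) :=
  {ω | ω ∈ states (Fin k → ι) ∧
    ∀ π : Equiv.Perm (Fin k), permOp π * ω * (permOp π)ᴴ = ω}

/-- The partial trace over all tensor factors but the `m`-th. -/
def reduced {ι : Type*} [Fintype ι] [DecidableEq ι] {k : ℕ} (m : Fin k)
    (ω : Matrix (Fin k → ι) (Fin k → ι) ℂ) : Matrix ι ι ℂ :=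
  Matrix.of fun x y =>
    ∑ i : Fin k → ι, if i m = x then ω i (Function.update i m y) else 0

/-- The set `T_k` of copy-correlated `k`-undistillable states on `ℂ^d ⊗ ℂ^d`, for `k ≥ 1`. -/
def copyCorrelatedKUndistillable (d k : ℕ) (hk : 0 < k) :
    Set (Matrix (Fin d × Fin d) (Fin d × Fin d) ℂ) :=
  {ρ | ρ ∈ states (Fin d × Fin d) ∧
    ∃ ω ∈ symmetricStates (Fin d × Fin d) k,
      regroup ω ∈ singleCopyUndistillable (Fin k → Fin d) (Fin k → Fin d) ∧
        ρ = reduced ⟨0, hk⟩ ω}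

/-- The set `T` of copy-correlated undistillable states on `ℂ^d ⊗ ℂ^d`. -/
def copyCorrelatedUndistillable (d : ℕ) :
    Set (Matrix (Fin d × Fin d) (Fin d × Fin d) ℂ) :=
  {ρ | ∀ (k : ℕ) (hk : 0 < k), ρ ∈ copyCorrelatedKUndistillable d k hk}

end CopyCorrelated

end

/-!
The inclusion `co(C) ⊆ T` holds because `C ⊆ T`, as witnessed by the tensor powers of an
undistillable state, and because `T` is convex: `F₂ ≥ 1 / 2` for every state, and `F₂ ≤ 1 / 2` is a
family of linear inequalities in the state (`SingletBounded`, `singletFraction_eq_half_iff`).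

For `T ⊆ co(C)`, a state in `T` is by compactness the one-copy marginal of an infinite exchangeable
family of `1`-undistillable states on `1, 2, 3, …` copies (`exists_mem_families`). Such families form
a compact convex set, the closed convex hull of its extreme points by the Krein–Milman theorem. The
extreme points are found as in Størmer's proof of the de Finetti theorem. Measuring one copy with a
product effect `|u⟩⟨u| ⊗ |v⟩⟨v|` is a local filter, so conditioning on it yields again an
exchangeable undistillable family (`Admissible.slice`). Since finitely many such effects sum to a
multiple of the identity, this decomposes the given family inside the cone of such families, and an
extreme family can only get rescaled (`slice_eq_smul_of_extreme`). Product effects also span all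
operators, so the measured copy is uncorrelated with the others, and an extreme family is a sequence
of tensor powers `σ^{⊗ k}` (`exists_eq_tensorPower_of_extreme`); its members being undistillable, `σ`
lies in `C`. No separate argument for the positivity or undistillability of the de Finetti components
is needed.

The marginal therefore maps the set of families into the closed convex hull of `C`, which is the
convex hull because `C` is compact and the space is finite-dimensional
(`isCompact_convexHull_of_finiteDimensional`).
-/

namespace CopyCorrelated

open Matrix

/-! ### Compactness of convex hulls -/

/-- In a finite-dimensional space the convex hull of a compact set is compact: by Carathéodory's
theorem it is the image of `stdSimplex × s ^ N` with `N = dim E + 1` under `(w, z) ↦ ∑ w i • z i`. -/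
theorem isCompact_convexHull_of_finiteDimensional {E : Type*} [AddCommGroup E] [Module ℝ E]
    [TopologicalSpace E] [IsTopologicalAddGroup E] [ContinuousSMul ℝ E] [FiniteDimensional ℝ E]
    {s : Set E} (hs : IsCompact s) : IsCompact (convexHull ℝ s) := by
  classical
  rcases s.eq_empty_or_nonempty with rfl | ⟨x₀, hx₀⟩
  · simp
  let N := Module.finrank ℝ E + 1
  let f : (Fin N → ℝ) × (Fin N → E) → E := fun p => ∑ i, p.1 i • p.2 i
  have hf : Continuous f := by fun_prop
  have hK : IsCompact (stdSimplex ℝ (Fin N) ×ˢ Set.univ.pi fun _ : Fin N => s) :=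
    (isCompact_stdSimplex ℝ _).prod (isCompact_univ_pi fun _ => hs)
  suffices convexHull ℝ s = f '' (stdSimplex ℝ (Fin N) ×ˢ Set.univ.pi fun _ : Fin N => s) by
    rw [this]
    exact hK.image hf
  apply subset_antisymm
  · intro x hx
    obtain ⟨κ, _, z, w, hz, hind, hw, hw1, rfl⟩ := eq_pos_convex_span_of_mem_convexHull hx
    have hcard : Fintype.card κ ≤ Fintype.card (Fin N) := by
      rw [Fintype.card_fin]
      exact hind.card_le_finrank_succ.trans (Nat.succ_le_succ (Submodule.finrank_le _))
    obtain ⟨g⟩ := Function.Embedding.nonempty_of_card_le hcard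
    have hout : ∀ i ∉ Set.range g, Function.extend g w 0 i = 0 := fun i hi => by
      rw [Function.extend_apply' _ _ _ (by simpa using hi)]
      rfl
    refine ⟨(Function.extend g w 0, Function.extend g z fun _ => x₀), ⟨⟨fun i => ?_, ?_⟩, ?_⟩, ?_⟩
    · by_cases hi : i ∈ Set.range g
      · obtain ⟨j, rfl⟩ := hi
        simpa [g.injective.extend_apply] using (hw j).le
      · exact (hout i hi).ge
    · rw [← hw1]
      exact (Fintype.sum_of_injective g g.injective _ _ hout
        fun i => by simp [g.injective.extend_apply]).symm
    · intro i _
      by_cases hi : i ∈ Set.range g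
      · obtain ⟨j, rfl⟩ := hi
        simpa [g.injective.extend_apply] using hz ⟨j, rfl⟩
      · simpa [Function.extend_apply' _ _ _ (by simpa using hi)] using hx₀
    · exact (Fintype.sum_of_injective g g.injective _ _ (fun i hi => by simp [hout i hi])
        fun i => by simp [g.injective.extend_apply]).symm
  · rintro _ ⟨⟨w, z⟩, ⟨⟨hw, hw1⟩, hz⟩, rfl⟩
    exact (convex_convexHull ℝ s).sum_mem (fun i _ => hw i) hw1
      fun i _ => subset_convexHull ℝ s (hz i trivial)

/-! ### Positive semidefinite matrices -/

theorem exists_eq_conjTranspose_mul_self {n : Type*} [Fintype n] {W : Matrix n n ℂ}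
    (hW : W.PosSemidef) : ∃ B : Matrix n n ℂ, W = Bᴴ * B := by
  classical
  open scoped MatrixOrder in
  exact CStarAlgebra.nonneg_iff_eq_star_mul_self.mp (Matrix.nonneg_iff_posSemidef.mpr hW)

theorem norm_apply_le_trace {n : Type*} [Fintype n] {W : Matrix n n ℂ} (hW : W.PosSemidef)
    (i j : n) : ‖W i j‖ ≤ W.trace.re := by
  have hdiag : ∀ i, (W i i).re ≤ W.trace.re := fun i => by
    rw [Matrix.trace, Complex.re_sum]
    exact Finset.single_le_sum (f := fun i => (W i i).re)
      (fun k _ => (Complex.nonneg_iff.mp (hW.diag_nonneg (i := k))).1) (Finset.mem_univ i)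
  obtain ⟨B, hB⟩ := exists_eq_conjTranspose_mul_self hW
  have hsq : ∀ i, (W i i).re = ∑ k, ‖B k i‖ ^ 2 := fun i => by
    rw [hB, Matrix.mul_apply, Complex.re_sum]
    refine Finset.sum_congr rfl fun k _ => ?_
    rw [conjTranspose_apply, ← Complex.normSq_eq_norm_sq, Complex.normSq_apply]
    simp
  have hle : ‖W i j‖ ≤ ∑ k, ‖B k i‖ * ‖B k j‖ := by
    rw [hB, Matrix.mul_apply]
    refine (norm_sum_le _ _).trans (Finset.sum_le_sum fun k _ => ?_)
    simp
  have hamgm : 2 * ∑ k, ‖B k i‖ * ‖B k j‖ ≤ (W i i).re + (W j j).re := by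
    rw [hsq, hsq, ← Finset.sum_add_distrib, Finset.mul_sum]
    refine Finset.sum_le_sum fun k _ => ?_
    nlinarith [sq_nonneg (‖B k i‖ - ‖B k j‖)]
  linarith [hdiag i, hdiag j]

theorem isClosed_setOf_posSemidef (n : Type*) [Fintype n] :
    IsClosed {W : Matrix n n ℂ | W.PosSemidef} := by
  have h : {W : Matrix n n ℂ | W.PosSemidef} =
      {W | Wᴴ = W} ∩ ⋂ x : n → ℂ, {W | 0 ≤ star x ⬝ᵥ W *ᵥ x} := by
    ext W
    simp [posSemidef_iff_dotProduct_mulVec, Matrix.IsHermitian]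
  rw [h]
  exact (isClosed_eq (by fun_prop) (by fun_prop)).inter
    (isClosed_iInter fun x => isClosed_le (by fun_prop) (by fun_prop))

/-! ### The singlet fraction as a linear condition -/

section Undistillable

variable {a b : Type*} [Fintype a] [Fintype b]

/-- The linear form of `F₂(ρ) ≤ 1 / 2`, meaningful for all operators: no local filter yields an
unnormalized output with singlet fraction above `1 / 2`. -/
def SingletBounded (ρ : Matrix (a × b) (a × b) ℂ) : Prop :=
  ∀ (A : Matrix a (Fin 2) ℂ) (B : Matrix b (Fin 2) ℂ),
    (filtered ρ A B * phi2).trace.re ≤ (filtered ρ A B).trace.re / 2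

theorem filtered_add (ρ σ : Matrix (a × b) (a × b) ℂ) (A : Matrix a (Fin 2) ℂ)
    (B : Matrix b (Fin 2) ℂ) : filtered (ρ + σ) A B = filtered ρ A B + filtered σ A B := by
  simp [filtered, Matrix.mul_add, Matrix.add_mul]

theorem filtered_smul (r : ℝ) (ρ : Matrix (a × b) (a × b) ℂ) (A : Matrix a (Fin 2) ℂ)
    (B : Matrix b (Fin 2) ℂ) : filtered (r • ρ) A B = r • filtered ρ A B := by
  simp [filtered]

theorem posSemidef_filtered {ρ : Matrix (a × b) (a × b) ℂ} (h : ρ.PosSemidef)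
    (A : Matrix a (Fin 2) ℂ) (B : Matrix b (Fin 2) ℂ) : (filtered ρ A B).PosSemidef :=
  h.conjTranspose_mul_mul_same _

theorem SingletBounded.add {ρ σ : Matrix (a × b) (a × b) ℂ} (hρ : SingletBounded ρ)
    (hσ : SingletBounded σ) : SingletBounded (ρ + σ) := fun A B => by
  have h1 := hρ A B
  have h2 := hσ A B
  simp only [filtered_add, Matrix.add_mul, trace_add, Complex.add_re]
  linarith

theorem SingletBounded.smul {ρ : Matrix (a × b) (a × b) ℂ} (hρ : SingletBounded ρ) {r : ℝ}
    (hr : 0 ≤ r) : SingletBounded (r • ρ) := fun A B => by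
  have h := mul_le_mul_of_nonneg_left (hρ A B) hr
  simp only [filtered_smul, Matrix.smul_mul, trace_smul, Complex.smul_re, smul_eq_mul]
  linarith

theorem SingletBounded.zero : SingletBounded (0 : Matrix (a × b) (a × b) ℂ) := fun A B => by
  simp [filtered]

/-- The singlet bound survives a local filter, because a further filter composes with it. -/
theorem SingletBounded.conj {c e : Type*} [Fintype c] [Fintype e]
    {ρ : Matrix (a × b) (a × b) ℂ} (hρ : SingletBounded ρ) (V : Matrix a c ℂ) (U : Matrix b e ℂ) :
    SingletBounded ((V ⊗ₖ U)ᴴ * ρ * (V ⊗ₖ U)) := fun A B => by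
  have h : filtered ((V ⊗ₖ U)ᴴ * ρ * (V ⊗ₖ U)) A B = filtered ρ (V * A) (U * B) := by
    simp only [filtered, mul_kronecker_mul, conjTranspose_mul, Matrix.mul_assoc]
  rw [h]
  exact hρ _ _

theorem isClosed_setOf_singletBounded :
    IsClosed {ρ : Matrix (a × b) (a × b) ℂ | SingletBounded ρ} := by
  simp only [SingletBounded, filtered, Set.ofPred_forall]
  exact isClosed_iInter fun A => isClosed_iInter fun B =>
    isClosed_le (Complex.continuous_re.comp (by fun_prop))
      ((Complex.continuous_re.comp (by fun_prop)).div_const 2)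

theorem posSemidef_one_sub_phi2 : (1 - phi2).PosSemidef := by
  have h : (1 - phi2) = (1 - phi2)ᴴ * (1 - phi2) := by
    ext ⟨i, j⟩ ⟨k, l⟩
    fin_cases i <;> fin_cases j <;> fin_cases k <;> fin_cases l <;>
      simp [phi2, Matrix.mul_apply, Fintype.sum_prod_type, Matrix.one_apply] <;> ring
  rw [h]
  exact posSemidef_conjTranspose_mul_self _

theorem re_trace_mul_nonneg {n : Type*} [Fintype n] {F Q : Matrix n n ℂ} (hF : F.PosSemidef)
    (hQ : Q.PosSemidef) : 0 ≤ (F * Q).trace.re := by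
  obtain ⟨B, rfl⟩ := exists_eq_conjTranspose_mul_self hQ
  rw [← Matrix.mul_assoc, trace_mul_comm, ← Matrix.mul_assoc]
  exact (Complex.nonneg_iff.mp (hF.mul_mul_conjTranspose_same B).trace_nonneg).1

theorem re_trace_mul_phi2_le {F : Matrix (Fin 2 × Fin 2) (Fin 2 × Fin 2) ℂ} (hF : F.PosSemidef) :
    (F * phi2).trace.re ≤ F.trace.re := by
  have h := re_trace_mul_nonneg hF posSemidef_one_sub_phi2
  rw [Matrix.mul_sub, Matrix.mul_one, trace_sub, Complex.sub_re] at h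
  linarith

/-- A product filter onto a basis vector `|i⟩ ⊗ |j⟩` with `⟨ij|ρ|ij⟩ ≠ 0` prepares a product state,
of singlet fraction exactly `1 / 2`; so `F₂ ≥ 1 / 2` for every state. -/
theorem exists_filtered_eq_half {ρ : Matrix (a × b) (a × b) ℂ} (hρ : ρ.trace = 1) :
    ∃ (A : Matrix a (Fin 2) ℂ) (B : Matrix b (Fin 2) ℂ), (filtered ρ A B).trace ≠ 0 ∧
      (filtered ρ A B * phi2).trace = (filtered ρ A B).trace / 2 := by
  classical
  obtain ⟨⟨i, j⟩, hij⟩ : ∃ p, ρ p p ≠ 0 := by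
    by_contra! h
    simp [Matrix.trace, h] at hρ
  have key : filtered ρ (Matrix.single i 0 1) (Matrix.single j 0 1) =
      Matrix.single (0, 0) (0, 0) (ρ (i, j) (i, j)) := by
    rw [filtered, single_kronecker_single, conjTranspose_single]
    simp
  refine ⟨Matrix.single i 0 1, Matrix.single j 0 1, ?_, ?_⟩
  · rw [key]
    simpa using hij
  · rw [key, trace_single_mul, trace_single_eq_same]
    simp [phi2]
    ring

theorem singletFraction_eq_half_iff {ρ : Matrix (a × b) (a × b) ℂ} (hρ : ρ ∈ states (a × b)) :
    singletFraction ρ = 1 / 2 ↔ SingletBounded ρ := by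
  have hpos : ∀ A B, (filtered ρ A B).trace ≠ 0 → 0 < (filtered ρ A B).trace.re := fun A B h => by
    have h0 := Complex.nonneg_iff.mp (posSemidef_filtered hρ.1 A B).trace_nonneg
    refine h0.1.lt_of_ne fun h' => h (Complex.ext h'.symm h0.2.symm)
  obtain ⟨A₀, B₀, h₀, h₀'⟩ := exists_filtered_eq_half hρ.2
  have hmem : (1 / 2 : ℝ) ∈ {r : ℝ | ∃ (A : Matrix a (Fin 2) ℂ) (B : Matrix b (Fin 2) ℂ),
      (filtered ρ A B).trace ≠ 0 ∧
        r = (filtered ρ A B * phi2).trace.re / (filtered ρ A B).trace.re} := by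
    refine ⟨A₀, B₀, h₀, ?_⟩
    have := hpos _ _ h₀
    rw [h₀', Complex.div_ofNat_re]
    field_simp
  constructor
  · intro h A B
    by_cases ht : (filtered ρ A B).trace = 0
    · rw [(posSemidef_filtered hρ.1 A B).trace_eq_zero_iff] at ht
      simp [ht]
    · have hle : (filtered ρ A B * phi2).trace.re / (filtered ρ A B).trace.re ≤ 1 / 2 := by
        rw [← h]
        refine le_csSup ⟨1, ?_⟩ ⟨A, B, ht, rfl⟩
        rintro _ ⟨A, B, h, rfl⟩
        rw [div_le_one (hpos A B h)]
        exact re_trace_mul_phi2_le (posSemidef_filtered hρ.1 A B)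
      rw [div_le_iff₀ (hpos A B ht)] at hle
      linarith
  · intro h
    refine IsGreatest.csSup_eq ⟨hmem, ?_⟩
    rintro _ ⟨A, B, ht, rfl⟩
    rw [div_le_iff₀ (hpos A B ht)]
    linarith [h A B]

end Undistillable

/-! ### Conditioning the first copy on the outcome of a measurement -/

section Slice

variable {ι : Type*} [Fintype ι] {k : ℕ}

theorem sum_fin_succ_arrow {M : Type*} [AddCommMonoid M] (f : (Fin (k + 1) → ι) → M) :
    ∑ z, f z = ∑ x, ∑ i, f (Fin.cons x i) := by
  rw [← (Fin.consEquiv fun _ => ι).sum_comp, Fintype.sum_prod_type]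
  rfl

/-- `(⟨e| ⊗ 1) W (|e⟩ ⊗ 1)`: the unnormalized state of the last `k` copies, given that the
effect `|e⟩⟨e|` was observed on the first of `k + 1` copies. -/
def slice (e : ι → ℂ) (W : Matrix (Fin (k + 1) → ι) (Fin (k + 1) → ι) ℂ) :
    Matrix (Fin k → ι) (Fin k → ι) ℂ :=
  Matrix.of fun i j => ∑ x, ∑ y, star (e x) * W (Fin.cons x i) (Fin.cons y j) * e y

/-- The partial trace over the first of `k + 1` copies. -/
def traceFirst (W : Matrix (Fin (k + 1) → ι) (Fin (k + 1) → ι) ℂ) :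
    Matrix (Fin k → ι) (Fin k → ι) ℂ :=
  Matrix.of fun i j => ∑ x, W (Fin.cons x i) (Fin.cons x j)

/-- The operator `|e⟩ ⊗ 1`, which prepends a copy in the state `e`. -/
def prepend [DecidableEq ι] (k : ℕ) (e : ι → ℂ) : Matrix (Fin (k + 1) → ι) (Fin k → ι) ℂ :=
  Matrix.of fun z i => if Fin.tail z = i then e (z 0) else 0

theorem slice_eq_conj [DecidableEq ι] (e : ι → ℂ)
    (W : Matrix (Fin (k + 1) → ι) (Fin (k + 1) → ι) ℂ) :
    slice e W = (prepend k e)ᴴ * W * prepend k e := by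
  ext i j
  simp only [slice, prepend, of_apply, mul_apply, conjTranspose_apply, sum_fin_succ_arrow,
    Fin.tail_cons, Fin.cons_zero, apply_ite star, star_zero, ite_mul, zero_mul, mul_ite, mul_zero,
    Finset.sum_ite_eq', Finset.mem_univ, if_true, Finset.sum_mul]
  exact Finset.sum_comm

/-- For a resolution `∑ |e_f⟩⟨e_f| = N` of a multiple of the identity, the slices add up to a
multiple of the partial trace. -/
theorem sum_slice_eq_smul_traceFirst [DecidableEq ι] {F : Type*} [Fintype F] (e : F → ι → ℂ)
    (N : ℝ) (he : ∀ x y, ∑ f, star (e f x) * e f y = if x = y then (N : ℂ) else 0)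
    (W : Matrix (Fin (k + 1) → ι) (Fin (k + 1) → ι) ℂ) :
    ∑ f, slice (e f) W = N • traceFirst W := by
  ext i j
  simp only [slice, traceFirst, Matrix.sum_apply, of_apply, Matrix.smul_apply, Complex.real_smul,
    Finset.mul_sum]
  rw [Finset.sum_comm]
  refine Finset.sum_congr rfl fun x _ => ?_
  rw [Finset.sum_comm]
  calc ∑ y, ∑ f, star (e f x) * W (Fin.cons x i) (Fin.cons y j) * e f y
      = ∑ y, (if x = y then (N : ℂ) else 0) * W (Fin.cons x i) (Fin.cons y j) := by
        refine Finset.sum_congr rfl fun y _ => ?_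
        rw [← he, Finset.sum_mul]
        exact Finset.sum_congr rfl fun f _ => by ring
    _ = _ := by simp

/-- Invariance of an operator under permutations of the copies. -/
def PermInvariant (W : Matrix (Fin k → ι) (Fin k → ι) ℂ) : Prop :=
  ∀ (π : Equiv.Perm (Fin k)) (i j : Fin k → ι), W (i ∘ π) (j ∘ π) = W i j

omit [Fintype ι] in
theorem cons_comp_perm (π : Equiv.Perm (Fin k)) (x : ι) (i : Fin k → ι) :
    (Fin.cons x (i ∘ π) : Fin (k + 1) → ι) =
      Fin.cons x i ∘ Equiv.Perm.decomposeFin.symm (0, π) := by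
  funext m
  refine Fin.cases ?_ (fun m => ?_) m <;> simp

theorem PermInvariant.slice {W : Matrix (Fin (k + 1) → ι) (Fin (k + 1) → ι) ℂ}
    (hW : PermInvariant W) (e : ι → ℂ) : PermInvariant (slice e W) := fun π i j => by
  simp only [CopyCorrelated.slice, of_apply, cons_comp_perm, hW _ _ _]

omit [Fintype ι] in
theorem PermInvariant.cons_cons_swap {W : Matrix (Fin (k + 2) → ι) (Fin (k + 2) → ι) ℂ}
    (hW : PermInvariant W) (x y x' y' : ι) (i j : Fin k → ι) :
    W (Fin.cons x (Fin.cons y i)) (Fin.cons x' (Fin.cons y' j)) =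
      W (Fin.cons y (Fin.cons x i)) (Fin.cons y' (Fin.cons x' j)) := by
  have h : ∀ (x y : ι) (i : Fin k → ι), (Fin.cons x (Fin.cons y i) : Fin (k + 2) → ι) =
      (Fin.cons y (Fin.cons x i) : Fin (k + 2) → ι) ∘ Equiv.swap 0 1 := fun x y i => by
    funext m
    refine Fin.cases ?_ (fun m => Fin.cases ?_ (fun m => ?_) m) m
    · rw [Function.comp_apply, Equiv.swap_apply_left]
      rfl
    · rw [Function.comp_apply, show (Fin.succ 0 : Fin (k + 2)) = 1 from rfl, Equiv.swap_apply_right]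
      rfl
    · have h1 : m.succ.succ ≠ (1 : Fin (k + 2)) :=
        fun h => Fin.succ_ne_zero m (Fin.succ_injective _ h)
      rw [Function.comp_apply, Equiv.swap_apply_of_ne_of_ne (Fin.succ_ne_zero _) h1]
      rfl
  rw [h x y, h x' y', hW]

theorem traceFirst_slice {W : Matrix (Fin (k + 2) → ι) (Fin (k + 2) → ι) ℂ}
    (hW : PermInvariant W) (e : ι → ℂ) :
    traceFirst (slice e W) = slice e (traceFirst W) := by
  ext i j
  simp only [traceFirst, slice, of_apply, Finset.mul_sum, Finset.sum_mul]
  rw [Finset.sum_comm]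
  refine Finset.sum_congr rfl fun x _ => ?_
  rw [Finset.sum_comm]
  refine Finset.sum_congr rfl fun y _ => Finset.sum_congr rfl fun z _ => ?_
  rw [hW.cons_cons_swap]

theorem trace_traceFirst (W : Matrix (Fin (k + 1) → ι) (Fin (k + 1) → ι) ℂ) :
    (traceFirst W).trace = W.trace := by
  simp only [Matrix.trace, diag_apply, traceFirst, of_apply, sum_fin_succ_arrow]
  exact Finset.sum_comm

theorem reduced_zero_apply [DecidableEq ι] (W : Matrix (Fin (k + 1) → ι) (Fin (k + 1) → ι) ℂ)
    (x y : ι) : reduced 0 W x y = ∑ i : Fin k → ι, W (Fin.cons x i) (Fin.cons y i) := by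
  simp only [reduced, of_apply, sum_fin_succ_arrow, Fin.cons_zero, Fin.update_cons_zero]
  rw [Finset.sum_comm]
  simp

theorem reduced_traceFirst [DecidableEq ι] {W : Matrix (Fin (k + 2) → ι) (Fin (k + 2) → ι) ℂ}
    (hW : PermInvariant W) : reduced 0 (traceFirst W) = reduced 0 W := by
  ext x y
  simp only [reduced_zero_apply, traceFirst, of_apply]
  rw [sum_fin_succ_arrow, Finset.sum_comm]
  exact Finset.sum_congr rfl fun i _ => Finset.sum_congr rfl fun z _ => hW.cons_cons_swap ..

theorem permInvariant_iff [DecidableEq ι] {W : Matrix (Fin k → ι) (Fin k → ι) ℂ} :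
    PermInvariant W ↔ ∀ π : Equiv.Perm (Fin k), permOp π * W * (permOp π)ᴴ = W := by
  have h : ∀ (π : Equiv.Perm (Fin k)) (i m : Fin k → ι), i = m ∘ π.symm ↔ m = i ∘ π :=
    fun π i m => by
      rw [Equiv.eq_comp_symm, eq_comm]
  have key : ∀ (π : Equiv.Perm (Fin k)) (i j : Fin k → ι),
      (permOp π * W * (permOp π)ᴴ : Matrix _ _ ℂ) i j = W (i ∘ π) (j ∘ π) := fun π i j => by
    simp [mul_apply, permOp, h, apply_ite]
  refine ⟨fun hW π => ?_, fun hW π i j => ?_⟩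
  · ext i j
    rw [key, hW]
  · rw [← key, hW]

end Slice

/-! ### The cone of symmetric undistillable operators -/

section Admissible

variable {a b : Type*} [Fintype a] [Fintype b] {k : ℕ}

/-- The vector `u ⊗ v`. -/
def tensorVec (u : a → ℂ) (v : b → ℂ) : a × b → ℂ := fun x => u x.1 * v x.2

/-- Positive permutation-invariant operators on `k` copies satisfying the linear form of
`F₂ ≤ 1 / 2`, without normalization of the trace. They form a convex cone. -/
structure Admissible (W : Matrix (Fin k → a × b) (Fin k → a × b) ℂ) : Prop where
  posSemidef : W.PosSemidef
  permInvariant : PermInvariant W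
  singletBounded : SingletBounded (regroup W)

theorem Admissible.zero : Admissible (0 : Matrix (Fin k → a × b) (Fin k → a × b) ℂ) :=
  ⟨.zero, fun _ _ _ => rfl, .zero⟩

theorem Admissible.add {W X : Matrix (Fin k → a × b) (Fin k → a × b) ℂ} (hW : Admissible W)
    (hX : Admissible X) : Admissible (W + X) where
  posSemidef := hW.posSemidef.add hX.posSemidef
  permInvariant π i j := by
    rw [Matrix.add_apply, Matrix.add_apply, hW.permInvariant, hX.permInvariant]
  singletBounded := hW.singletBounded.add hX.singletBounded

theorem Admissible.smul {W : Matrix (Fin k → a × b) (Fin k → a × b) ℂ} (hW : Admissible W)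
    {r : ℝ} (hr : 0 ≤ r) : Admissible (r • W) where
  posSemidef := hW.posSemidef.smul hr
  permInvariant π i j := by
    rw [Matrix.smul_apply, Matrix.smul_apply, hW.permInvariant]
  singletBounded := hW.singletBounded.smul hr

theorem Admissible.sum {F : Type*} (s : Finset F)
    {W : F → Matrix (Fin k → a × b) (Fin k → a × b) ℂ} (hW : ∀ f ∈ s, Admissible (W f)) :
    Admissible (∑ f ∈ s, W f) :=
  Finset.sum_induction _ _ (fun _ _ => .add) .zero hW

/-- A local measurement on one copy is a local filter, so it does not create distillability. -/
theorem Admissible.slice {W : Matrix (Fin (k + 1) → a × b) (Fin (k + 1) → a × b) ℂ}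
    (hW : Admissible W) (u : a → ℂ) (v : b → ℂ) : Admissible (slice (tensorVec u v) W) := by
  classical
  refine ⟨?_, hW.permInvariant.slice _, ?_⟩
  · rw [slice_eq_conj]
    exact hW.posSemidef.conjTranspose_mul_mul_same _
  · have h : regroup (CopyCorrelated.slice (tensorVec u v) W) =
        (prepend k u ⊗ₖ prepend k v)ᴴ * regroup W * (prepend k u ⊗ₖ prepend k v) := by
      have h1 : (prepend k u ⊗ₖ prepend k v) = (prepend k (tensorVec u v)).submatrix
          (Equiv.arrowProdEquivProdArrow (Fin (k + 1)) (fun _ => a) (fun _ => b)).symm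
          (Equiv.arrowProdEquivProdArrow (Fin k) (fun _ => a) (fun _ => b)).symm := by
        ext ⟨z, w⟩ ⟨i, j⟩
        have h2 : (Fin.tail (fun m => (z m, w m)) = fun m => (i m, j m)) ↔
            Fin.tail z = i ∧ Fin.tail w = j := by
          simp [funext_iff, Fin.tail, forall_and]
        simp only [prepend, tensorVec, Equiv.arrowProdEquivProdArrow, kroneckerMap_apply,
          submatrix_apply, of_apply, Equiv.coe_fn_symm_mk, h2]
        split_ifs <;> simp_all
      have h3 : regroup W = W.submatrix
          (Equiv.arrowProdEquivProdArrow (Fin (k + 1)) (fun _ => a) (fun _ => b)).symm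
          (Equiv.arrowProdEquivProdArrow (Fin (k + 1)) (fun _ => a) (fun _ => b)).symm := rfl
      rw [h1, h3, conjTranspose_submatrix, submatrix_mul_equiv, submatrix_mul_equiv,
        ← slice_eq_conj]
      rfl
    rw [h]
    exact hW.singletBounded.conj _ _

theorem Admissible.traceFirst {W : Matrix (Fin (k + 1) → a × b) (Fin (k + 1) → a × b) ℂ}
    (hW : Admissible W) : Admissible (traceFirst W) := by
  classical
  have h := sum_slice_eq_smul_traceFirst
    (fun x : a × b => tensorVec (Pi.single x.1 1) (Pi.single x.2 1)) 1 (fun x y => by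
      simp [tensorVec, Pi.single_apply, Fintype.sum_prod_type, Prod.ext_iff, ite_and]
      split_ifs <;> simp) W
  rw [one_smul] at h
  rw [← h]
  exact Admissible.sum _ fun x _ => hW.slice _ _

omit [Fintype a] [Fintype b] in
theorem posSemidef_regroup {W : Matrix (Fin k → a × b) (Fin k → a × b) ℂ} (hW : W.PosSemidef) :
    (regroup W).PosSemidef :=
  hW.submatrix _

theorem trace_regroup (W : Matrix (Fin k → a × b) (Fin k → a × b) ℂ) :
    (regroup W).trace = W.trace :=
  (Equiv.arrowProdEquivProdArrow (Fin k) (fun _ => a) (fun _ => b)).symm.sum_comp fun i => W i i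

/-- For states, admissibility is permutation invariance together with `F₂ = 1 / 2`. -/
theorem admissible_and_trace_iff [DecidableEq a] [DecidableEq b]
    {W : Matrix (Fin k → a × b) (Fin k → a × b) ℂ} :
    (Admissible W ∧ W.trace = 1) ↔ W ∈ symmetricStates (a × b) k ∧
      regroup W ∈ singleCopyUndistillable (Fin k → a) (Fin k → b) := by
  constructor
  · rintro ⟨h, htr⟩
    have hs : regroup W ∈ states ((Fin k → a) × (Fin k → b)) :=
      ⟨posSemidef_regroup h.posSemidef, (trace_regroup W).trans htr⟩
    exact ⟨⟨⟨h.posSemidef, htr⟩, permInvariant_iff.mp h.permInvariant⟩, hs,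
      (singletFraction_eq_half_iff hs).mpr h.singletBounded⟩
  · rintro ⟨⟨⟨hpsd, htr⟩, hperm⟩, hs, hF⟩
    exact ⟨⟨hpsd, permInvariant_iff.mpr hperm, (singletFraction_eq_half_iff hs).mp hF⟩, htr⟩

theorem isClosed_setOf_admissible :
    IsClosed {W : Matrix (Fin k → a × b) (Fin k → a × b) ℂ | Admissible W} := by
  have h : {W : Matrix (Fin k → a × b) (Fin k → a × b) ℂ | Admissible W} =
      {W | W.PosSemidef} ∩ {W | PermInvariant W} ∩ {W | SingletBounded (regroup W)} := by
    ext W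
    exact ⟨fun h => ⟨⟨h.1, h.2⟩, h.3⟩, fun h => ⟨h.1.1, h.1.2, h.2⟩⟩
  rw [h]
  refine ((isClosed_setOf_posSemidef _).inter ?_).inter
    (isClosed_setOf_singletBounded.preimage (f := regroup) ?_)
  · simp only [PermInvariant, Set.ofPred_forall]
    exact isClosed_iInter fun π => isClosed_iInter fun i => isClosed_iInter fun j =>
      isClosed_eq (by fun_prop) (by fun_prop)
  · exact continuous_id.matrix_submatrix _ _

end Admissible

/-! ### Tensor powers -/

section TensorPower

variable {ι : Type*} [Fintype ι]

theorem posSemidef_tensorPower {ρ : Matrix ι ι ℂ} (hρ : ρ.PosSemidef) (n : ℕ) :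
    (tensorPower ρ n).PosSemidef := by
  classical
  obtain ⟨B, rfl⟩ := exists_eq_conjTranspose_mul_self hρ
  have h : tensorPower (Bᴴ * B) n = (tensorPower B n)ᴴ * tensorPower B n := by
    ext i j
    simp only [tensorPower, of_apply, mul_apply, conjTranspose_apply, Finset.prod_univ_sum,
      Fintype.piFinset_univ, star_prod, Finset.prod_mul_distrib]
  rw [h]
  exact posSemidef_conjTranspose_mul_self _

omit [Fintype ι] in
theorem tensorPower_cons (ρ : Matrix ι ι ℂ) (n : ℕ) (x y : ι) (i j : Fin n → ι) :
    tensorPower ρ (n + 1) (Fin.cons x i) (Fin.cons y j) = ρ x y * tensorPower ρ n i j := by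
  simp [tensorPower, Fin.prod_univ_succ]

theorem trace_tensorPower (ρ : Matrix ι ι ℂ) (n : ℕ) :
    (tensorPower ρ n).trace = ρ.trace ^ n := by
  classical
  simp only [Matrix.trace, diag_apply, tensorPower, of_apply]
  rw [← Fintype.piFinset_univ,
    ← Finset.prod_univ_sum (fun _ : Fin n => Finset.univ) fun _ x => ρ x x]
  simp

omit [Fintype ι] in
theorem permInvariant_tensorPower (ρ : Matrix ι ι ℂ) (n : ℕ) :
    PermInvariant (tensorPower ρ n) := fun π i j =>
  Equiv.prod_comp π fun m => ρ (i m) (j m)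

theorem reduced_tensorPower [DecidableEq ι] {ρ : Matrix ι ι ℂ} (hρ : ρ.trace = 1) (n : ℕ) :
    reduced 0 (tensorPower ρ (n + 1)) = ρ := by
  ext x y
  simp only [reduced_zero_apply, tensorPower_cons, ← Finset.mul_sum]
  have := trace_tensorPower ρ n
  rw [hρ, one_pow, Matrix.trace] at this
  simp only [diag_apply] at this
  rw [this, mul_one]

/-- A state is undistillable if and only if all its tensor powers are admissible. -/
theorem mem_undistillable_iff {d : ℕ} {ρ : Matrix (Fin d × Fin d) (Fin d × Fin d) ℂ} :
    ρ ∈ undistillable d ↔ ρ ∈ states (Fin d × Fin d) ∧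
      ∀ n : ℕ, Admissible (tensorPower ρ (n + 1)) := by
  have hs : ∀ n, ρ ∈ states (Fin d × Fin d) →
      regroup (tensorPower ρ n) ∈ states ((Fin n → Fin d) × (Fin n → Fin d)) := fun n h =>
    ⟨posSemidef_regroup (posSemidef_tensorPower h.1 n), by
      rw [trace_regroup, trace_tensorPower, h.2, one_pow]⟩
  constructor
  · intro h
    have hρ := (h 1 one_pos).1
    exact ⟨hρ, fun n => ⟨posSemidef_tensorPower hρ.1 _, permInvariant_tensorPower ρ _,
      (singletFraction_eq_half_iff (hs _ hρ)).mp (h (n + 1) n.succ_pos).2⟩⟩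
  · rintro ⟨hρ, h⟩ n hn
    obtain ⟨n, rfl⟩ := Nat.exists_eq_succ_of_ne_zero hn.ne'
    exact ⟨hρ, (singletFraction_eq_half_iff (hs _ hρ)).mpr (h n).singletBounded⟩

end TensorPower

/-! ### Polarization vectors -/

section Polarization

variable {ι : Type*} [Fintype ι] [DecidableEq ι]

/-- The vector `|p⟩ + iⁿ |q⟩`, indexed by `(p, q, n)`. These finitely many vectors form a tight
frame, and their rank-one projections span all operators. -/
def polarVec (f : ι × ι × Fin 4) : ι → ℂ :=
  Pi.single f.1 1 + (Complex.I ^ (f.2.2 : ℕ)) • Pi.single f.2.1 1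

theorem sum_star_polarVec_mul (x y : ι) :
    ∑ f, star (polarVec f x) * polarVec f y =
      if x = y then ((8 * Fintype.card ι : ℝ) : ℂ) else 0 := by
  have h : ∀ p q : ι, ∑ n : Fin 4, star (polarVec (p, q, n) x) * polarVec (p, q, n) y =
      4 * ((if x = p then 1 else 0) * (if y = p then 1 else 0) +
        (if x = q then 1 else 0) * (if y = q then 1 else 0)) := fun p q => by
    have h3 : Complex.I ^ 3 = -Complex.I := Complex.I_pow_three
    simp only [polarVec, Fin.sum_univ_four, Pi.add_apply, Pi.smul_apply, Pi.single_apply,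
      smul_eq_mul]
    split_ifs <;> simp [h3] <;> ring_nf <;> simp <;> ring
  simp only [Fintype.sum_prod_type, h]
  simp only [← Finset.mul_sum, Finset.sum_add_distrib, Finset.sum_const, Finset.card_univ]
  split_ifs with hxy
  · simp [hxy]
    ring
  · simp [hxy]

theorem eq_zero_of_forall_polarVec {D : ι → ι → ℂ}
    (h : ∀ f, ∑ x, ∑ y, star (polarVec f x) * D x y * polarVec f y = 0) (p q : ι) : D p q = 0 := by
  have key : ∀ n : Fin 4, D p p + Complex.I ^ (n : ℕ) * D p q +
      star (Complex.I ^ (n : ℕ)) * D q p +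
        star (Complex.I ^ (n : ℕ)) * Complex.I ^ (n : ℕ) * D q q = 0 := fun n => by
    rw [← h (p, q, n)]
    simp [polarVec, Pi.single_apply, add_mul, mul_add, Finset.sum_add_distrib,
      apply_ite (starRingEnd ℂ)]
    ring
  have h0 := key 0
  have h1 := key 1
  have h2 := key 2
  have h3 := key 3
  have hI3 : Complex.I ^ 3 = -Complex.I := Complex.I_pow_three
  simp [hI3] at h0 h1 h2 h3
  have hsum : D p q + D q p = 0 := by linear_combination (h0 - h2) / 2
  have hdiff : Complex.I * (D p q - D q p) = 0 := by linear_combination (h1 - h3) / 2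
  have := (mul_eq_zero.mp hdiff).resolve_left Complex.I_ne_zero
  linear_combination (hsum + this) / 2

/-- Product effects are tomographically complete. -/
theorem eq_zero_of_forall_tensorVec_polarVec {a b : Type*} [Fintype a] [Fintype b]
    [DecidableEq a] [DecidableEq b] {D : a × b → a × b → ℂ}
    (h : ∀ f g, ∑ x, ∑ y, star (tensorVec (polarVec f) (polarVec g) x) * D x y *
      tensorVec (polarVec f) (polarVec g) y = 0) (x y : a × b) : D x y = 0 := by
  refine eq_zero_of_forall_polarVec (D := fun x₂ y₂ => D (x.1, x₂) (y.1, y₂)) (fun g => ?_) x.2 y.2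
  refine eq_zero_of_forall_polarVec (D := fun x₁ y₁ => ∑ x₂, ∑ y₂,
    star (polarVec g x₂) * D (x₁, x₂) (y₁, y₂) * polarVec g y₂) (fun f => ?_) x.1 y.1
  rw [← h f g]
  simp only [Fintype.sum_prod_type, Finset.mul_sum, Finset.sum_mul]
  refine Finset.sum_congr rfl fun x₁ _ => ?_
  rw [Finset.sum_comm]
  refine Finset.sum_congr rfl fun x₂ _ => Finset.sum_congr rfl fun y₁ _ =>
    Finset.sum_congr rfl fun y₂ _ => ?_
  simp only [tensorVec, star_mul']
  ring

theorem sum_star_tensorVec_polarVec_mul {a b : Type*} [Fintype a] [Fintype b]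
    [DecidableEq a] [DecidableEq b] (x y : a × b) :
    ∑ f : (a × a × Fin 4) × (b × b × Fin 4), star (tensorVec (polarVec f.1) (polarVec f.2) x) *
      tensorVec (polarVec f.1) (polarVec f.2) y =
      if x = y then (((8 * Fintype.card a) * (8 * Fintype.card b) : ℝ) : ℂ) else 0 := by
  have h : ∀ f : (a × a × Fin 4) × (b × b × Fin 4),
      star (tensorVec (polarVec f.1) (polarVec f.2) x) * tensorVec (polarVec f.1) (polarVec f.2) y =
        (star (polarVec f.1 x.1) * polarVec f.1 y.1) *
          (star (polarVec f.2 x.2) * polarVec f.2 y.2) := fun f => by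
    simp only [tensorVec, star_mul']
    ring
  simp only [h]
  rw [Fintype.sum_prod_type]
  dsimp only
  rw [← Finset.sum_mul_sum, sum_star_polarVec_mul, sum_star_polarVec_mul]
  simp only [Prod.ext_iff]
  split_ifs <;> simp_all

end Polarization

/-! ### Exchangeable undistillable families -/

section Families

variable (a b : Type*) [Fintype a] [Fintype b]

/-- Families `(ω k)` of admissible operators on `k` copies such that each `ω k` is the partial trace
of `ω (k + 1)`. -/
def familyCone : Set (∀ k : ℕ, Matrix (Fin k → a × b) (Fin k → a × b) ℂ) :=
  {ω | (∀ k, Admissible (ω k)) ∧ ∀ k, ω k = traceFirst (ω (k + 1))}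

/-- The states of an infinite exchangeable sequence of copies all of whose finite marginals are
`1`-undistillable. -/
def families : Set (∀ k : ℕ, Matrix (Fin k → a × b) (Fin k → a × b) ℂ) :=
  {ω | ω ∈ familyCone a b ∧ (ω 0).trace = 1}

variable {a b}

theorem traceFirst_add {ι : Type*} [Fintype ι] {k : ℕ}
    (W X : Matrix (Fin (k + 1) → ι) (Fin (k + 1) → ι) ℂ) :
    traceFirst (W + X) = traceFirst W + traceFirst X := by
  ext i j
  simp [traceFirst, Finset.sum_add_distrib]

theorem traceFirst_smul {ι : Type*} [Fintype ι] {k : ℕ} (r : ℝ)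
    (W : Matrix (Fin (k + 1) → ι) (Fin (k + 1) → ι) ℂ) :
    traceFirst (r • W) = r • traceFirst W := by
  ext i j
  simp [traceFirst, Finset.mul_sum]

theorem add_mem_familyCone {ω η : ∀ k : ℕ, Matrix (Fin k → a × b) (Fin k → a × b) ℂ}
    (hω : ω ∈ familyCone a b) (hη : η ∈ familyCone a b) : ω + η ∈ familyCone a b :=
  ⟨fun k => (hω.1 k).add (hη.1 k), fun k => by
    rw [Pi.add_apply, Pi.add_apply, traceFirst_add, ← hω.2, ← hη.2]⟩

theorem smul_mem_familyCone {ω : ∀ k : ℕ, Matrix (Fin k → a × b) (Fin k → a × b) ℂ}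
    (hω : ω ∈ familyCone a b) {r : ℝ} (hr : 0 ≤ r) : r • ω ∈ familyCone a b :=
  ⟨fun k => (hω.1 k).smul hr, fun k => by
    rw [Pi.smul_apply, Pi.smul_apply, traceFirst_smul, ← hω.2]⟩

theorem sum_mem_familyCone {F : Type*} (s : Finset F)
    {ω : F → ∀ k : ℕ, Matrix (Fin k → a × b) (Fin k → a × b) ℂ}
    (hω : ∀ f ∈ s, ω f ∈ familyCone a b) : ∑ f ∈ s, ω f ∈ familyCone a b := by
  refine Finset.sum_induction _ (· ∈ familyCone a b) (fun _ _ => add_mem_familyCone) ?_ hω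
  exact ⟨fun k => .zero, fun k => by ext; simp [traceFirst]⟩

theorem slice_mem_familyCone {ω : ∀ k : ℕ, Matrix (Fin k → a × b) (Fin k → a × b) ℂ}
    (hω : ω ∈ familyCone a b) (u : a → ℂ) (v : b → ℂ) :
    (fun k => slice (tensorVec u v) (ω (k + 1))) ∈ familyCone a b :=
  ⟨fun k => (hω.1 (k + 1)).slice u v, fun k => by
    rw [traceFirst_slice (hω.1 (k + 2)).permInvariant, ← hω.2]⟩

theorem convex_families : Convex ℝ (families a b) := by
  rintro ω ⟨hω, hω1⟩ η ⟨hη, hη1⟩ r s hr hs hrs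
  refine ⟨add_mem_familyCone (smul_mem_familyCone hω hr) (smul_mem_familyCone hη hs), ?_⟩
  simp only [Pi.add_apply, Pi.smul_apply, trace_add, trace_smul, hω1, hη1, Complex.real_smul,
    mul_one]
  exact_mod_cast hrs

theorem trace_eq_one_of_mem_families {ω : ∀ k : ℕ, Matrix (Fin k → a × b) (Fin k → a × b) ℂ}
    (hω : ω ∈ families a b) (k : ℕ) : (ω k).trace = 1 := by
  induction k with
  | zero => exact hω.2
  | succ k ih => rw [← trace_traceFirst, ← hω.1.2, ih]

/-- The matrices with entries of modulus at most one. -/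
def unitBox (n : Type*) : Set (Matrix n n ℂ) := {W | ∀ i j, ‖W i j‖ ≤ 1}

theorem isCompact_unitBox (n : Type*) : IsCompact (unitBox n) := by
  have h : IsCompact (Set.univ.pi fun _ : n => Set.univ.pi fun _ : n =>
      Metric.closedBall (0 : ℂ) 1) :=
    isCompact_univ_pi fun _ => isCompact_univ_pi fun _ => isCompact_closedBall _ _
  have heq : (Set.univ.pi fun _ : n => Set.univ.pi fun _ : n =>
      Metric.closedBall (0 : ℂ) 1) = unitBox n := by
    ext W
    simp only [Set.mem_pi, Set.mem_univ, true_implies, mem_closedBall_zero_iff]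
    rfl
  exact heq ▸ h

theorem mem_unitBox {n : Type*} [Fintype n] {W : Matrix n n ℂ} (hW : W.PosSemidef)
    (htr : W.trace = 1) : W ∈ unitBox n := fun i j => by
  simpa [htr] using norm_apply_le_trace hW i j

theorem continuous_traceFirst {ι : Type*} [Fintype ι] {k : ℕ} :
    Continuous (traceFirst : Matrix (Fin (k + 1) → ι) (Fin (k + 1) → ι) ℂ → _) := by
  refine continuous_matrix fun i j => ?_
  simp only [traceFirst, of_apply]
  fun_prop

theorem isCompact_families : IsCompact (families a b) := by
  refine IsCompact.of_isClosed_subset (isCompact_univ_pi fun k => isCompact_unitBox (Fin k → a × b))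
    ?_ fun ω hω k _ => mem_unitBox (hω.1.1 k).posSemidef (trace_eq_one_of_mem_families hω k)
  have h : families a b = ((⋂ k, {ω | Admissible (ω k)}) ∩
      ⋂ k, {ω | ω k = traceFirst (ω (k + 1))}) ∩ {ω | (ω 0).trace = 1} := by
    ext ω
    simp [families, familyCone]
  rw [h]
  refine ((isClosed_iInter fun k => ?_).inter (isClosed_iInter fun k => ?_)).inter ?_
  · exact isClosed_setOf_admissible.preimage (continuous_apply k)
  · exact isClosed_eq (continuous_apply k) (continuous_traceFirst.comp (continuous_apply _))
  · exact isClosed_eq ((continuous_apply 0).matrix_trace) continuous_const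

/-! ### Extreme families are sequences of tensor powers -/

theorem trace_eq_ofReal_re {n : Type*} [Fintype n] {W : Matrix n n ℂ} (hW : W.PosSemidef) :
    W.trace = (W.trace.re : ℂ) :=
  Complex.ext rfl (Complex.nonneg_iff.mp hW.trace_nonneg).2.symm

theorem normalize_add_mem_families {ω η : ∀ k : ℕ, Matrix (Fin k → a × b) (Fin k → a × b) ℂ}
    (hω : ω ∈ families a b) (hη : η ∈ familyCone a b) :
    (1 + (η 0).trace.re)⁻¹ • (ω + η) ∈ families a b := by
  have h0 : 0 ≤ (η 0).trace.re := (Complex.nonneg_iff.mp (hη.1 0).posSemidef.trace_nonneg).1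
  refine ⟨smul_mem_familyCone (add_mem_familyCone hω.1 hη) (by positivity), ?_⟩
  rw [Pi.smul_apply, Pi.add_apply, trace_smul, trace_add, hω.2,
    trace_eq_ofReal_re (hη.1 0).posSemidef, Complex.real_smul]
  have : (1 + (η 0).trace.re) ≠ 0 := by positivity
  push_cast
  exact inv_mul_cancel₀ (by exact_mod_cast this)

/-- Measuring one copy with a product effect decomposes an exchangeable family within the cone, so
an extreme family only gets rescaled. -/
theorem slice_eq_smul_of_extreme [DecidableEq a] [DecidableEq b]
    {ω : ∀ k : ℕ, Matrix (Fin k → a × b) (Fin k → a × b) ℂ}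
    (hω : ω ∈ (families a b).extremePoints ℝ) (f : a × a × Fin 4) (g : b × b × Fin 4) :
    ∃ c : ℝ, ∀ k, slice (tensorVec (polarVec f) (polarVec g)) (ω (k + 1)) = c • ω k := by
  obtain ⟨hmem, hext⟩ := mem_extremePoints_iff_left.mp hω
  let S : (a × a × Fin 4) × (b × b × Fin 4) →
      ∀ k : ℕ, Matrix (Fin k → a × b) (Fin k → a × b) ℂ :=
    fun p k => slice (tensorVec (polarVec p.1) (polarVec p.2)) (ω (k + 1))
  have hS : ∀ p, S p ∈ familyCone a b := fun p => slice_mem_familyCone hmem.1 _ _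
  set s := S (f, g) with hs
  set r := ∑ p ∈ Finset.univ.erase (f, g), S p with hr
  set N : ℝ := (8 * Fintype.card a) * (8 * Fintype.card b)
  have hr_mem : r ∈ familyCone a b := sum_mem_familyCone _ fun p _ => hS p
  have hsum : s + r = N • ω := by
    rw [hs, hr, Finset.add_sum_erase _ _ (Finset.mem_univ _)]
    funext k
    rw [Finset.sum_apply, sum_slice_eq_smul_traceFirst _ N sum_star_tensorVec_polarVec_mul,
      ← hmem.1.2 k, Pi.smul_apply]
  have hs0 : 0 ≤ (s 0).trace.re :=
    (Complex.nonneg_iff.mp ((hS _).1 0).posSemidef.trace_nonneg).1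
  have hr0 : 0 ≤ (r 0).trace.re :=
    (Complex.nonneg_iff.mp (hr_mem.1 0).posSemidef.trace_nonneg).1
  have hN : (s 0).trace.re + (r 0).trace.re = N := by
    rw [← Complex.add_re, ← trace_add, ← Pi.add_apply, hsum, Pi.smul_apply, trace_smul, hmem.2]
    simp
  -- Adding `ω` to both parts keeps the two normalizations nonzero.
  have hfix : (1 + (s 0).trace.re)⁻¹ • (ω + s) = ω := by
    refine hext _ (normalize_add_mem_families hmem (hS _)) _
      (normalize_add_mem_families hmem hr_mem)
      ⟨(1 + (s 0).trace.re) / (2 + N), (1 + (r 0).trace.re) / (2 + N), ?_, ?_, ?_, ?_⟩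
    · rw [← hN]; positivity
    · rw [← hN]; positivity
    · rw [← hN]; field_simp; ring
    · have h2 : (2 + N) ≠ 0 := by rw [← hN]; positivity
      rw [smul_smul, smul_smul, div_mul_eq_mul_div, div_mul_eq_mul_div,
        mul_inv_cancel₀ (by positivity), mul_inv_cancel₀ (by positivity), ← smul_add,
        show ω + s + (ω + r) = (2 + N) • ω by rw [add_smul, ← hsum, two_smul]; abel,
        smul_smul, one_div, inv_mul_cancel₀ h2, one_smul]
  refine ⟨(s 0).trace.re, fun k => ?_⟩
  rw [inv_smul_eq_iff₀ (by positivity), add_smul, one_smul] at hfix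
  exact congrFun (add_left_cancel hfix) k

/-- The quantum de Finetti theorem in extreme-point form. -/
theorem exists_eq_tensorPower_of_extreme
    {ω : ∀ k : ℕ, Matrix (Fin k → a × b) (Fin k → a × b) ℂ}
    (hω : ω ∈ (families a b).extremePoints ℝ) :
    ∃ σ ∈ states (a × b), ∀ k, ω k = tensorPower σ k := by
  classical
  have hmem := hω.1
  let σ : Matrix (a × b) (a × b) ℂ := (ω 1).submatrix (fun x _ => x) fun x _ => x
  have hzero : ∀ i j, ω 0 i j = 1 := fun i j => by
    have h := hmem.2
    rw [Matrix.trace, Fintype.sum_subsingleton _ i] at h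
    rwa [Subsingleton.elim j i]
  have hone : ∀ (x y : a × b) (i j : Fin 0 → a × b), ω 1 (Fin.cons x i) (Fin.cons y j) = σ x y :=
    fun x y i j => by
      simp only [σ, submatrix_apply]
      congr 1 <;> exact funext fun m => Fin.cases rfl (fun m => m.elim0) m
  have hstep : ∀ (k : ℕ) (i j : Fin k → a × b) (x y : a × b),
      ω (k + 1) (Fin.cons x i) (Fin.cons y j) - σ x y * ω k i j = 0 := fun k i j => by
    refine eq_zero_of_forall_tensorVec_polarVec
      (D := fun x y => ω (k + 1) (Fin.cons x i) (Fin.cons y j) - σ x y * ω k i j) fun f g => ?_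
    obtain ⟨c, hc⟩ := slice_eq_smul_of_extreme hω f g
    have h1 := congrFun (congrFun (hc k) i) j
    have h2 := congrFun (congrFun (hc 0) Fin.elim0) Fin.elim0
    simp only [slice, of_apply, Matrix.smul_apply, hzero, hone, Complex.real_smul, mul_one]
      at h1 h2
    calc _ = (∑ x, ∑ y, star (tensorVec (polarVec f) (polarVec g) x) *
          ω (k + 1) (Fin.cons x i) (Fin.cons y j) * tensorVec (polarVec f) (polarVec g) y) -
        (∑ x, ∑ y, star (tensorVec (polarVec f) (polarVec g) x) * σ x y *
          tensorVec (polarVec f) (polarVec g) y) * ω k i j := by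
            simp only [Finset.sum_mul, ← Finset.sum_sub_distrib]
            refine Finset.sum_congr rfl fun x _ => Finset.sum_congr rfl fun y _ => ?_
            rw [mul_sub, sub_mul]
            congr 1
            ring
      _ = 0 := by rw [h1, h2, sub_self]
  have hpow : ∀ k, ω k = tensorPower σ k := fun k => by
    induction k with
    | zero =>
      ext i j
      simp [hzero, tensorPower]
    | succ k ih =>
      ext i j
      rw [← Fin.cons_self_tail i, ← Fin.cons_self_tail j, tensorPower_cons, ← ih]
      exact sub_eq_zero.mp (hstep k _ _ _ _)
  refine ⟨σ, ⟨(hmem.1.1 1).posSemidef.submatrix _, ?_⟩, hpow⟩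
  have h := trace_eq_one_of_mem_families hmem 1
  rwa [hpow, trace_tensorPower, pow_one] at h

/-! ### Extension of compatible finite families -/

theorem exists_family_of_admissible (N : ℕ) {W : Matrix (Fin N → a × b) (Fin N → a × b) ℂ}
    (hW : Admissible W) :
    ∃ τ : ∀ k : ℕ, Matrix (Fin k → a × b) (Fin k → a × b) ℂ, τ N = W ∧
      (∀ k ≤ N, Admissible (τ k)) ∧ (∀ k < N, τ k = traceFirst (τ (k + 1))) ∧
      ∀ k > N, τ k = 0 := by
  induction N with
  | zero =>
    refine ⟨Function.update 0 0 W, by simp, fun k hk => ?_, by simp, fun k hk => ?_⟩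
    · obtain rfl := Nat.le_zero.mp hk
      simpa using hW
    · rw [Function.update_of_ne (by omega)]
      rfl
  | succ N ih =>
    obtain ⟨τ, h1, h2, h3, h4⟩ := ih hW.traceFirst
    refine ⟨Function.update τ (N + 1) W, by simp, fun k hk => ?_, fun k hk => ?_, fun k hk => ?_⟩
    · rcases eq_or_ne k (N + 1) with rfl | hne
      · simpa using hW
      · rw [Function.update_of_ne hne]
        exact h2 k (by omega)
    · rw [Function.update_of_ne (by omega)]
      rcases eq_or_ne k N with rfl | hne
      · rw [Function.update_self, h1]
      · rw [Function.update_of_ne (by omega)]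
        exact h3 k (by omega)
    · rw [Function.update_of_ne (by omega)]
      exact h4 k (by omega)

theorem continuous_reduced {ι : Type*} [Fintype ι] [DecidableEq ι] {k : ℕ} (m : Fin k) :
    Continuous (reduced m : Matrix (Fin k → ι) (Fin k → ι) ℂ → _) := by
  refine continuous_matrix fun x y => ?_
  simp only [reduced, of_apply]
  refine continuous_finsetSum _ fun i _ => ?_
  split_ifs <;> fun_prop

/-- If `ρ` extends to a `1`-undistillable exchangeable state on any finite number of copies, then it
extends to an infinite exchangeable family, by compactness. -/
theorem exists_mem_families [DecidableEq a] [DecidableEq b] {ρ : Matrix (a × b) (a × b) ℂ}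
    (h : ∀ k : ℕ, ∃ W : Matrix (Fin (k + 1) → a × b) (Fin (k + 1) → a × b) ℂ,
      Admissible W ∧ W.trace = 1 ∧ reduced 0 W = ρ) :
    ∃ ω ∈ families a b, reduced 0 (ω 1) = ρ := by
  let t : ℕ → Set (∀ k : ℕ, Matrix (Fin k → a × b) (Fin k → a × b) ℂ) := fun N =>
    (Set.univ.pi fun k => unitBox (Fin k → a × b)) ∩ ((⋂ k ≤ N, {ω | Admissible (ω k)}) ∩
      (⋂ k < N, {ω | ω k = traceFirst (ω (k + 1))})) ∩
        {ω | (ω 0).trace = 1 ∧ reduced 0 (ω 1) = ρ}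
  have hbox : IsCompact (Set.univ.pi fun k => unitBox (Fin k → a × b)) :=
    isCompact_univ_pi fun k => isCompact_unitBox _
  have hclosed : ∀ N, IsClosed (t N) := fun N => by
    refine (hbox.isClosed.inter (.inter ?_ ?_)).inter (.inter ?_ ?_)
    · exact isClosed_biInter fun k _ =>
        isClosed_setOf_admissible.preimage (continuous_apply k)
    · exact isClosed_biInter fun k _ =>
        isClosed_eq (continuous_apply k) (continuous_traceFirst.comp (continuous_apply _))
    · exact isClosed_eq ((continuous_apply 0).matrix_trace) continuous_const
    · exact isClosed_eq ((continuous_reduced 0).comp (continuous_apply 1)) continuous_const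
  obtain ⟨ω, hω⟩ := IsCompact.nonempty_iInter_of_sequence_nonempty_isCompact_isClosed t
    (fun N ω hω => by
      simp only [t, Set.mem_inter_iff, Set.mem_iInter, Set.mem_ofPred_eq] at hω ⊢
      exact ⟨⟨hω.1.1, fun k hk => hω.1.2.1 k (by omega), fun k hk => hω.1.2.2 k (by omega)⟩, hω.2⟩)
    (fun N => by
      obtain ⟨W, hW, htr, hred⟩ := h N
      obtain ⟨τ, h1, h2, h3, h4⟩ := exists_family_of_admissible (N + 1) hW
      have htrace : ∀ k ≤ N + 1, (τ k).trace = (τ 0).trace := fun k hk => by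
        induction k with
        | zero => rfl
        | succ k ih => rw [← trace_traceFirst, ← h3 k (by omega), ih (by omega)]
      have htr0 : (τ 0).trace = 1 := by rw [← htrace (N + 1) le_rfl, h1, htr]
      have hreduced : ∀ k ≤ N, reduced 0 (τ (k + 1)) = reduced 0 (τ 1) := fun k hk => by
        induction k with
        | zero => rfl
        | succ k ih =>
          rw [← reduced_traceFirst (h2 (k + 2) (by omega)).permInvariant,
            ← h3 (k + 1) (by omega), ih (by omega)]
      refine ⟨τ, ⟨fun k _ => ?_, ?_, ?_⟩, htr0, ?_⟩
      · rcases le_or_gt k (N + 1) with hk | hk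
        · exact mem_unitBox (h2 k hk).posSemidef ((htrace k hk).trans htr0)
        · rw [h4 k hk]
          intro i j
          simp
      · simp only [Set.mem_iInter]
        exact fun k hk => h2 k (by omega)
      · simp only [Set.mem_iInter]
        exact fun k hk => h3 k (by omega)
      · rw [← hreduced N le_rfl, h1, hred])
    (hbox.of_isClosed_subset (hclosed 0) fun ω hω => hω.1.1) hclosed
  simp only [t, Set.mem_iInter, Set.mem_inter_iff, Set.mem_ofPred_eq] at hω
  exact ⟨ω, ⟨⟨fun k => (hω k).1.2.1 k le_rfl, fun k => (hω (k + 1)).1.2.2 k (by omega)⟩,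
    (hω 0).2.1⟩, (hω 0).2.2⟩

end Families

/-! ### Undistillable states and their convex hull -/

theorem isCompact_undistillable (d : ℕ) : IsCompact (undistillable d) := by
  have h : undistillable d = ({ρ | ρ.PosSemidef} ∩ {ρ | ρ.trace = 1}) ∩
      ⋂ n : ℕ, {ρ | Admissible (tensorPower ρ (n + 1))} := by
    ext ρ
    simp [mem_undistillable_iff, states]
  refine (isCompact_unitBox (Fin d × Fin d)).of_isClosed_subset ?_ fun ρ hρ =>
    mem_unitBox (mem_undistillable_iff.mp hρ).1.1 (mem_undistillable_iff.mp hρ).1.2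
  rw [h]
  refine ((isClosed_setOf_posSemidef _).inter (isClosed_eq (by fun_prop) continuous_const)).inter
    (isClosed_iInter fun n => isClosed_setOf_admissible.preimage ?_)
  refine continuous_matrix fun i j => ?_
  simp only [tensorPower, of_apply]
  fun_prop

theorem reduced_add {ι : Type*} [Fintype ι] [DecidableEq ι] {k : ℕ} (m : Fin k)
    (W X : Matrix (Fin k → ι) (Fin k → ι) ℂ) : reduced m (W + X) = reduced m W + reduced m X := by
  ext x y
  simp only [reduced, of_apply, Matrix.add_apply, ← Finset.sum_add_distrib]
  exact Finset.sum_congr rfl fun i _ => by split_ifs <;> simp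

theorem reduced_smul {ι : Type*} [Fintype ι] [DecidableEq ι] {k : ℕ} (m : Fin k) (r : ℝ)
    (W : Matrix (Fin k → ι) (Fin k → ι) ℂ) : reduced m (r • W) = r • reduced m W := by
  ext x y
  simp only [reduced, of_apply, Matrix.smul_apply, Finset.smul_sum]
  exact Finset.sum_congr rfl fun i _ => by split_ifs <;> simp

theorem convex_states (ι : Type*) [Fintype ι] : Convex ℝ (states ι) := by
  rintro ρ ⟨hρ, hρ1⟩ σ ⟨hσ, hσ1⟩ r s hr hs hrs
  refine ⟨(hρ.smul hr).add (hσ.smul hs), ?_⟩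
  rw [trace_add, trace_smul, trace_smul, hρ1, hσ1, ← add_smul, hrs, one_smul]

theorem mem_copyCorrelatedKUndistillable_iff {d k : ℕ} (hk : 0 < k)
    {ρ : Matrix (Fin d × Fin d) (Fin d × Fin d) ℂ} :
    ρ ∈ copyCorrelatedKUndistillable d k hk ↔ ρ ∈ states (Fin d × Fin d) ∧
      ∃ W : Matrix (Fin k → Fin d × Fin d) (Fin k → Fin d × Fin d) ℂ,
        Admissible W ∧ W.trace = 1 ∧ reduced ⟨0, hk⟩ W = ρ := by
  refine and_congr_right fun _ => exists_congr fun W => ?_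
  rw [← and_assoc, ← and_assoc, ← admissible_and_trace_iff, eq_comm (a := ρ)]

theorem convex_copyCorrelatedUndistillable (d : ℕ) :
    Convex ℝ (copyCorrelatedUndistillable d) := by
  intro ρ hρ σ hσ r s hr hs hrs k hk
  obtain ⟨hρ, W, hW, hW1, rfl⟩ := (mem_copyCorrelatedKUndistillable_iff hk).mp (hρ k hk)
  obtain ⟨hσ, X, hX, hX1, rfl⟩ := (mem_copyCorrelatedKUndistillable_iff hk).mp (hσ k hk)
  refine (mem_copyCorrelatedKUndistillable_iff hk).mpr ⟨convex_states _ hρ hσ hr hs hrs,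
    r • W + s • X, (hW.smul hr).add (hX.smul hs),
    (convex_states _ ⟨hW.posSemidef, hW1⟩ ⟨hX.posSemidef, hX1⟩ hr hs hrs).2, ?_⟩
  rw [reduced_add, reduced_smul, reduced_smul]

theorem undistillable_subset_copyCorrelatedUndistillable (d : ℕ) :
    undistillable d ⊆ copyCorrelatedUndistillable d := by
  intro ρ hρ k hk
  obtain ⟨k, rfl⟩ := Nat.exists_eq_succ_of_ne_zero hk.ne'
  obtain ⟨hs, hadm⟩ := mem_undistillable_iff.mp hρ
  exact (mem_copyCorrelatedKUndistillable_iff hk).mpr ⟨hs, tensorPower ρ (k + 1), hadm k,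
    by rw [trace_tensorPower, hs.2, one_pow], reduced_tensorPower hs.2 k⟩

instance {m n : Type*} : LocallyConvexSpace ℝ (Matrix m n ℂ) :=
  inferInstanceAs (LocallyConvexSpace ℝ (m → n → ℂ))

/-- The one-copy marginal of a family, as a linear map. -/
def firstMarginal (ι : Type*) [Fintype ι] [DecidableEq ι] :
    (∀ k : ℕ, Matrix (Fin k → ι) (Fin k → ι) ℂ) →ₗ[ℝ] Matrix ι ι ℂ where
  toFun ω := reduced 0 (ω 1)
  map_add' ω η := reduced_add 0 (ω 1) (η 1)
  map_smul' r ω := reduced_smul 0 r (ω 1)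

theorem firstMarginal_mem_undistillable_of_extreme {d : ℕ}
    {ω : ∀ k : ℕ, Matrix (Fin k → Fin d × Fin d) (Fin k → Fin d × Fin d) ℂ}
    (hω : ω ∈ (families (Fin d) (Fin d)).extremePoints ℝ) :
    firstMarginal (Fin d × Fin d) ω ∈ undistillable d := by
  obtain ⟨σ, hσ, hpow⟩ := exists_eq_tensorPower_of_extreme hω
  have h : firstMarginal (Fin d × Fin d) ω = σ := by
    change reduced 0 (ω 1) = σ
    rw [hpow]
    exact reduced_tensorPower hσ.2 0
  rw [h, mem_undistillable_iff]
  exact ⟨hσ, fun n => hpow (n + 1) ▸ hω.1.1.1 (n + 1)⟩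

theorem copyCorrelatedUndistillable_subset_convexHull (d : ℕ) :
    copyCorrelatedUndistillable d ⊆ convexHull ℝ (undistillable d) := by
  intro ρ hρ
  obtain ⟨ω, hω, rfl⟩ := exists_mem_families (ρ := ρ) fun k =>
    ((mem_copyCorrelatedKUndistillable_iff k.succ_pos).mp (hρ (k + 1) k.succ_pos)).2
  have hcont : Continuous (firstMarginal (Fin d × Fin d)) :=
    (continuous_reduced 0).comp (continuous_apply 1)
  rw [← closure_convexHull_extremePoints isCompact_families convex_families] at hω
  have hmem := image_closure_subset_closure_image hcont (Set.mem_image_of_mem _ hω)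
  rw [(firstMarginal (Fin d × Fin d)).image_convexHull] at hmem
  rw [← (isCompact_convexHull_of_finiteDimensional
    (isCompact_undistillable d)).isClosed.closure_eq]
  refine closure_mono (convexHull_mono ?_) hmem
  rintro _ ⟨η, hη, rfl⟩
  exact firstMarginal_mem_undistillable_of_extreme hη

end CopyCorrelated

theorem theorem1 (d : ℕ) :
    CopyCorrelated.copyCorrelatedUndistillable d =
      convexHull ℝ (CopyCorrelated.undistillable d) :=
  (CopyCorrelated.copyCorrelatedUndistillable_subset_convexHull d).antisymm
    (convexHull_min (CopyCorrelated.undistillable_subset_copyCorrelatedUndistillable d)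
      (CopyCorrelated.convex_copyCorrelatedUndistillable d))
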